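/- Let $\mathcal M$ be a von Neumann algebra acting on a complex Hilbert space $H$, and let $a$ be a positive selfadjoint (possibly unbounded) operator on $H$ affiliated with $\mathcal M$, with spectral decomposition $a=\int_{[0,\infty)}\lambda\,dP_\lambda$. Put $$a_0=\int_{[0,1]}\lambda\,dP_\lambda,\qquad a_\infty=\int_{(1,\infty)}\lambda\,dP_\lambda .$$ For $\alpha,\beta>0$ let $\mathcal S^{\alpha,\beta}_{0,\infty}$ be the linear space of all sesquilinear forms $$(f,g)\mapsto\langle x\,a_\infty^{\beta}f,\;a_0^{\alpha}g\rangle,\qquad (f,g)\in D(a_\infty^\beta)\times D(a_0^\alpha),\qquad x\in\mathcal M .$$ Forms belonging to different spaces $\mathcal S^{\alpha,\beta}_{0,\infty}$ are identified when they agree on the common domain $\bigcap_{\beta>0}D(a_\infty^\beta)\times\bigcap_{\alpha>0}D(a_0^\alpha)$; unions, intersections and inclusions below are taken in this sense. Define $$\overline{\mathfrak L_{0,\infty}}=\bigcap_{\alpha>0}\bigcup_{\beta>0}\mathcal S^{\alpha,\beta}_{0,\infty},\qquad \underline{\mathfrak L_{0,\infty}}=\bigcup_{\beta>0}\bigcap_{\alpha>0}\mathcal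 S^{\alpha,\beta}_{0,\infty},$$ $$\overline{\lim}\,\mathcal S^{\alpha,\alpha}_{0,\infty}=\bigcap_{\alpha>0}\bigcup_{\beta\ge\alpha}\mathcal S^{\beta,\beta}_{0,\infty},\qquad \underline{\lim}\,\mathcal S^{\alpha,\alpha}_{0,\infty}=\bigcup_{\alpha>0}\bigcap_{\beta\ge\alpha}\mathcal S^{\beta,\beta}_{0,\infty}.$$ Then $$\overline{\mathfrak L_{0,\infty}}\supset\overline{\lim}\,\mathcal S^{\alpha,\alpha}_{0,\infty}\supset\underline{\lim}\,\mathcal S^{\alpha,\alpha}_{0,\infty}\supset\underline{\mathfrak L_{0,\infty}} .$$ Consequently, if the family $\mathcal S^{\alpha,\beta}_{0,\infty}$ converges to $\mathfrak L_{0,\infty}$, that is, $\underline{\mathfrak L_{0,\infty}}=\overline{\mathfrak L_{0,\infty}}=\mathfrak L_{0,\infty}$, then $\overline{\lim}\,\mathcal S^{\alpha,\alpha}_{0,\infty}=\underline{\lim}\,\mathcal S^{\alpha,\alpha}_{0,\infty}=\mathfrak L_{0,\infty}$. -/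

import Mathlib

noncomputable section

namespace OperatorLimits

open scoped InnerProductSpace

/-! ### Positive selfadjoint operators and affiliation -/

section Operators

variable {H : Type*} [NormedAddCommGroup H] [InnerProductSpace ℂ H] [CompleteSpace H]

/-- `T` is a positive selfadjoint, possibly unbounded, operator: `T† = T` (for a `LinearPMap` this
forces the domain to be dense) and `⟨T f, f⟩ ≥ 0` for every `f` in the domain. -/
structure IsPositiveSelfAdjoint (T : H →ₗ.[ℂ] H) : Prop where
  isSelfAdjoint : IsSelfAdjoint T
  nonneg : ∀ f : T.domain, 0 ≤ (⟪T f, (f : H)⟫_ℂ).re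

/-- `T` is affiliated with the von Neumann algebra `M`: every unitary `u` of the commutant of `M`
satisfies `u T ⊆ T u` (applied to `u` and `u⁻¹` this says `u T u⁻¹ = T`). -/
def IsAffiliated (M : VonNeumannAlgebra H) (T : H →ₗ.[ℂ] H) : Prop :=
  ∀ u ∈ M.commutant, u ∈ unitary (H →L[ℂ] H) →
    ∀ f : T.domain, ∃ hf : u (f : H) ∈ T.domain, T ⟨u (f : H), hf⟩ = u (T f)

/-! ### The bounded operator `(1 + T)⁻¹` -/

/-- `R` is a bounded everywhere defined two-sided inverse of `1 + T`. -/
def IsInvOneAdd (T : H →ₗ.[ℂ] H) (R : H →L[ℂ] H) : Prop :=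
  (∀ f : H, ∃ hf : R f ∈ T.domain, R f + T ⟨R f, hf⟩ = f) ∧
    ∀ f : T.domain, R ((f : H) + T f) = f

/-- The operator `(1 + T)⁻¹`; it exists whenever `T` is positive and selfadjoint, see
`isInvOneAdd_invOneAdd`. -/
def invOneAdd (T : H →ₗ.[ℂ] H) : H →L[ℂ] H :=
  open Classical in if h : ∃ R, IsInvOneAdd T R then h.choose else 0

theorem norm_le_of_nonneg {T : H →ₗ.[ℂ] H} (hT : IsPositiveSelfAdjoint T) (f : T.domain) :
    ‖(f : H)‖ ≤ ‖(f : H) + T f‖ := by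
  have h1 : ‖(f : H)‖ ^ 2 ≤ (⟪(f : H) + T f, (f : H)⟫_ℂ).re := by
    rw [inner_add_left, Complex.add_re]
    have h2 := hT.nonneg f
    have h3 : (⟪(f : H), (f : H)⟫_ℂ).re = ‖(f : H)‖ ^ 2 := by
      simpa using inner_self_eq_norm_sq (𝕜 := ℂ) (f : H)
    linarith
  have h4 : (⟪(f : H) + T f, (f : H)⟫_ℂ).re ≤ ‖(f : H) + T f‖ * ‖(f : H)‖ :=
    (Complex.re_le_norm _).trans (norm_inner_le_norm _ _)
  rcases (norm_nonneg (f : H)).eq_or_lt with h | h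
  · rw [← h]; exact norm_nonneg _
  · nlinarith

theorem exists_isInvOneAdd {T : H →ₗ.[ℂ] H} (hT : IsPositiveSelfAdjoint T) :
    ∃ R, IsInvOneAdd T R := by
  let A : T.domain →ₗ[ℂ] H := T.domain.subtype + T.toFun
  have hA : ∀ f, A f = (f : H) + T f := fun f => rfl
  have hbd : ∀ f : T.domain, ‖(f : H)‖ ≤ ‖A f‖ := fun f => norm_le_of_nonneg hT f
  have hinj : Function.Injective A := by
    rw [← LinearMap.ker_eq_bot, LinearMap.ker_eq_bot']
    intro f hf
    have := hbd f
    rw [hf, norm_zero] at this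
    exact Subtype.ext (norm_le_zero_iff.1 this)
  have hdense : Dense (T.domain : Set H) := hT.isSelfAdjoint.dense_domain
  have hclosedT : T.IsClosed := hT.isSelfAdjoint.isClosed
  have hclosed : IsClosed (LinearMap.range A : Set H) := by
    refine IsSeqClosed.isClosed ?_
    intro y z hy hz
    choose f hf using hy
    have hcau : CauchySeq (fun n => (f n : H)) := by
      have hyc := hz.cauchySeq
      rw [Metric.cauchySeq_iff] at hyc ⊢
      intro ε hε
      obtain ⟨N, hN⟩ := hyc ε hε
      refine ⟨N, fun m hm n hn => lt_of_le_of_lt ?_ (hN m hm n hn)⟩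
      rw [dist_eq_norm, dist_eq_norm, ← hf m, ← hf n, ← map_sub]
      exact hbd (f m - f n)
    obtain ⟨w, hw⟩ := cauchySeq_tendsto_of_complete hcau
    have hTf : Filter.Tendsto (fun n => T (f n)) Filter.atTop (nhds (z - w)) := by
      have := hz.sub hw
      refine this.congr fun n => ?_
      rw [← hf n, hA]; abel
    have hmem : (w, z - w) ∈ T.graph := by
      have hc : IsClosed (T.graph : Set (H × H)) := hclosedT
      exact hc.mem_of_tendsto (hw.prodMk_nhds hTf)
        (Filter.Eventually.of_forall fun n => T.mem_graph (f n))
    rw [LinearPMap.mem_graph_iff] at hmem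
    obtain ⟨v, hv1, hv2⟩ := hmem
    refine ⟨v, ?_⟩
    rw [hA, hv1, hv2]
    simp
  have htop : LinearMap.range A = ⊤ := by
    have : CompleteSpace (LinearMap.range A) := hclosed.completeSpace_coe
    rw [← Submodule.orthogonal_eq_bot_iff, Submodule.eq_bot_iff]
    intro y hy
    rw [Submodule.mem_orthogonal] at hy
    have key : ∀ f : T.domain, ⟪-y, (f : H)⟫_ℂ = ⟪y, T f⟫_ℂ := by
      intro f
      have h := hy (A f) ⟨f, rfl⟩
      rw [hA, inner_add_left] at h
      have h' := congrArg (starRingEnd ℂ) h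
      rw [map_add, inner_conj_symm, inner_conj_symm, map_zero] at h'
      rw [inner_neg_left]
      linear_combination -h'
    have hmem : y ∈ T.adjoint.domain := LinearPMap.mem_adjoint_domain_of_exists y ⟨-y, key⟩
    have hval : T.adjoint ⟨y, hmem⟩ = -y := LinearPMap.adjoint_apply_eq hdense ⟨y, hmem⟩ key
    have hg : (y, -y) ∈ T.graph := by
      have : (y, -y) ∈ T.adjoint.graph := by
        rw [← hval]
        exact T.adjoint.mem_graph ⟨y, hmem⟩
      rwa [LinearPMap.isSelfAdjoint_def.1 hT.isSelfAdjoint] at this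
    rw [LinearPMap.mem_graph_iff] at hg
    obtain ⟨v, hv1, hv2⟩ := hg
    have := hbd v
    rw [hA, hv2, hv1] at this
    simpa using this
  let e : T.domain ≃ₗ[ℂ] H := LinearEquiv.ofBijective A ⟨hinj, LinearMap.range_eq_top.1 htop⟩
  have he : ∀ f, e f = (f : H) + T f := fun f => rfl
  refine ⟨(T.domain.subtype ∘ₗ e.symm.toLinearMap).mkContinuous 1 fun g => ?_, fun f => ?_,
    fun f => ?_⟩
  · have := hbd (e.symm g)
    rw [one_mul]
    refine this.trans (le_of_eq ?_)
    exact congrArg norm (e.apply_symm_apply g)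
  · exact ⟨(e.symm f).2, e.apply_symm_apply f⟩
  · exact congrArg Subtype.val (e.symm_apply_apply f)

theorem isInvOneAdd_invOneAdd {T : H →ₗ.[ℂ] H} (hT : IsPositiveSelfAdjoint T) :
    IsInvOneAdd T (invOneAdd T) := by
  have h := exists_isInvOneAdd hT
  rw [invOneAdd, dif_pos h]
  exact h.choose_spec

/-! ### Powers and spectral projections -/

/-- The power `T ^ α` (for `α > 0`) of a positive selfadjoint operator `T`. With `R = (1 + T)⁻¹`,
so that `T R = 1 - R`, it is the operator `(1 - R) ^ α ∘ (R ^ α)⁻¹`; the bounded powers are given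
by the continuous functional calculus. Its domain is the range of `R ^ α = (1 + T) ^ (-α)`, that
is `D((1 + T) ^ α) = D(T ^ α)`, and `T ^ α (R ^ α g) = (1 - R) ^ α g`, because
`λ ^ α * (1 + λ) ^ (-α) = (1 - (1 + λ)⁻¹) ^ α` for `λ ≥ 0`. -/
def power (T : H →ₗ.[ℂ] H) (α : ℝ) : H →ₗ.[ℂ] H :=
  (cfc (fun t : ℝ => (1 - t) ^ α) (invOneAdd T) : H →L[ℂ] H).toLinearMap.compPMap
    ((cfc (fun t : ℝ => t ^ α) (invOneAdd T) : H →L[ℂ] H).toLinearMap.toPMap ⊤).inverse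

/-- The spectral projection `P_c = ∫_{[0, c]} dP_λ` of a positive selfadjoint operator `T`: the
orthogonal projection onto the kernel of the positive part of `1 - (1 + c) (1 + T)⁻¹`. Indeed
`1 - (1 + c) / (1 + λ) ≤ 0` exactly when `λ ≤ c`. -/
def spectralProjection (T : H →ₗ.[ℂ] H) (c : ℝ) : H →L[ℂ] H :=
  (LinearMap.ker ((1 - (1 + c) • invOneAdd T)⁺ : H →L[ℂ] H).toLinearMap).starProjection

/-- The product `T p` of an operator `T` and a bounded operator `p`, with its natural domain
`{f | p f ∈ D(T)}`. -/
def mulBounded (T : H →ₗ.[ℂ] H) (p : H →L[ℂ] H) : H →ₗ.[ℂ] H where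
  domain := T.domain.comap p.toLinearMap
  toFun := T.toFun ∘ₗ p.toLinearMap.restrict (fun _ h => h)

/-- `a₀ = ∫_{[0, 1]} λ dP_λ = a p₀`, where `p₀ = ∫_{[0, 1]} dP_λ`. -/
def partZero (a : H →ₗ.[ℂ] H) : H →ₗ.[ℂ] H := mulBounded a (spectralProjection a 1)

/-- `a_∞ = ∫_{(1, ∞)} λ dP_λ = a p_∞`, where `p_∞ = ∫_{(1, ∞)} dP_λ = 1 - p₀`. -/
def partInfty (a : H →ₗ.[ℂ] H) : H →ₗ.[ℂ] H := mulBounded a (1 - spectralProjection a 1)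

/-! ### Spaces of sesquilinear forms -/

/-- Sesquilinear forms on `V × W`, linear in the first and conjugate linear in the second
variable. -/
abbrev Form (V W : Submodule ℂ H) : Type _ := V →ₗ[ℂ] W →ₗ⋆[ℂ] ℂ

/-- The map sending `x` to the sesquilinear form `(a x b)^ : (f, g) ↦ ⟨x b f, a g⟩` on
`D(b) × D(a)`. The scalar product of Mathlib is linear in its second variable. -/
def sandwich (a b : H →ₗ.[ℂ] H) : (H →L[ℂ] H) →ₗ[ℂ] Form b.domain a.domain where
  toFun x := LinearMap.mk₂'ₛₗ (RingHom.id ℂ) (starRingEnd ℂ) (fun f g => ⟪a g, x (b f)⟫_ℂ)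
    (fun f₁ f₂ g => by simp [LinearPMap.map_add])
    (fun c f g => by simp [LinearPMap.map_smul])
    (fun f g₁ g₂ => by simp [LinearPMap.map_add])
    (fun c f g => by simp [LinearPMap.map_smul, mul_comm])
  map_add' x y := by ext f g; simp
  map_smul' c x := by ext f g; simp

/-- The linear space `S_{a,b}(M) = {(a x b)^ | x ∈ M}` of sesquilinear forms on `D(b) × D(a)`. -/
def formSpace (M : VonNeumannAlgebra H) (a b : H →ₗ.[ℂ] H) :
    Submodule ℂ (Form b.domain a.domain) :=
  (Subalgebra.toSubmodule M.toStarSubalgebra.toSubalgebra).map (sandwich a b)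

/-- Restriction of sesquilinear forms to smaller subspaces. -/
def restrictForm {V V' W W' : Submodule ℂ H} (hV : V' ≤ V) (hW : W' ≤ W) :
    Form V W →ₗ[ℂ] Form V' W' where
  toFun φ := LinearMap.mk₂'ₛₗ (RingHom.id ℂ) (starRingEnd ℂ)
    (fun f g => φ (Submodule.inclusion hV f) (Submodule.inclusion hW g))
    (fun f₁ f₂ g => by simp) (fun c f g => by simp) (fun f g₁ g₂ => by simp)
    (fun c f g => by simp)
  map_add' _ _ := rfl
  map_smul' _ _ := rfl

/-- The common domain `⋂_{α > 0} D(T ^ α)` of all powers of `T`, which is a core of each of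
them. -/
def commonDomain (T : H →ₗ.[ℂ] H) : Submodule ℂ H :=
  ⨅ (α : ℝ) (_ : 0 < α), (power T α).domain

theorem commonDomain_le (T : H →ₗ.[ℂ] H) {α : ℝ} (hα : 0 < α) :
    commonDomain T ≤ (power T α).domain :=
  iInf₂_le α hα

/-- The forms on which all the spaces `S_{0,∞}^{α,β}` are compared: sesquilinear forms on
`⋂_{β > 0} D(a_∞ ^ β) × ⋂_{α > 0} D(a₀ ^ α)` (the second factor is all of `H`). -/
abbrev CommonForm (a : H →ₗ.[ℂ] H) : Type _ :=
  Form (commonDomain (partInfty a)) (commonDomain (partZero a))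

/-- The space `S_{0,∞}^{α,β} = S_{a₀^α, a_∞^β}(M)` for `α, β > 0`. The forms in these spaces have
different domains for different `β`; a form is identified with its restriction to the common
domain. -/
def family (M : VonNeumannAlgebra H) (a : H →ₗ.[ℂ] H) (α β : Set.Ioi (0 : ℝ)) :
    Submodule ℂ (CommonForm a) :=
  (formSpace M (power (partZero a) α) (power (partInfty a) β)).map
    (restrictForm (commonDomain_le (partInfty a) β.2) (commonDomain_le (partZero a) α.2))

end Operators

/-! ### Limits of a two-parameter family of subspaces -/

section Limits

variable {X : Type*} [AddCommGroup X] [Module ℂ X]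

/-- `𝔖₀^α = ⋃_{β > 0} S^{α,β}`. -/
def unionSpace (S : Set.Ioi (0 : ℝ) → Set.Ioi (0 : ℝ) → Submodule ℂ X) (α : Set.Ioi (0 : ℝ)) :
    Set X :=
  ⋃ β, (S α β : Set X)

/-- `𝔖_∞^β = ⋂_{α > 0} S^{α,β}`. -/
def interSpace (S : Set.Ioi (0 : ℝ) → Set.Ioi (0 : ℝ) → Submodule ℂ X) (β : Set.Ioi (0 : ℝ)) :
    Set X :=
  ⋂ α, (S α β : Set X)

/-- The upper limit `⋂_{α > 0} 𝔖₀^α`. -/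
def upperLimit (S : Set.Ioi (0 : ℝ) → Set.Ioi (0 : ℝ) → Submodule ℂ X) : Set X :=
  ⋂ α, unionSpace S α

/-- The lower limit `⋃_{β > 0} 𝔖_∞^β`. -/
def lowerLimit (S : Set.Ioi (0 : ℝ) → Set.Ioi (0 : ℝ) → Submodule ℂ X) : Set X :=
  ⋃ β, interSpace S β

/-- The upper limit `⋂_{α > 0} ⋃_{β ≥ α} S^{β,β}` of the diagonal family. -/
def diagLimsup (S : Set.Ioi (0 : ℝ) → Set.Ioi (0 : ℝ) → Submodule ℂ X) : Set X :=
  ⋂ α, ⋃ β, ⋃ _ : α ≤ β, (S β β : Set X)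

/-- The lower limit `⋃_{α > 0} ⋂_{β ≥ α} S^{β,β}` of the diagonal family. -/
def diagLiminf (S : Set.Ioi (0 : ℝ) → Set.Ioi (0 : ℝ) → Submodule ℂ X) : Set X :=
  ⋃ α, ⋂ β, ⋂ _ : α ≤ β, (S β β : Set X)

/-- The family `S` converges to `L`: its lower and upper limits coincide, and `L` is their common
value. -/
def ConvergesTo (S : Set.Ioi (0 : ℝ) → Set.Ioi (0 : ℝ) → Submodule ℂ X) (L : Set X) : Prop :=
  lowerLimit S = L ∧ upperLimit S = L

end Limits

end OperatorLimits

end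

/-! The family shrinks as `α` grows and grows as `β` grows; the rest is order theory. If `α ≤ β`,
then `S^{β,β} ⊆ S^{α,β}`, which gives the first inclusion; if `β ≤ β'`, then `S^{β',β} ⊆ S^{β',β'}`,
which gives the last; the middle one is liminf ⊆ limsup.

For the monotonicity, write `a₀^(α+δ) = a₀^δ a₀^α` and `a_∞^β = a_∞^(-δ) a_∞^(β+δ)`. The factors
`a₀^δ` and `a_∞^(-δ)` (set to be bounded on the kernel) are bounded and lie in `M`, so they can be
absorbed into `x`: see `exists_mem_power_partZero` and `exists_mem_power_partInfty`.

Powers are functions of the resolvent `(1 + T)⁻¹`, so boundedness is a statement about spectra: the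
resolvent of `a₀` has spectrum in `[1/2, 1]`, that of `a_∞` in `[0, 1/2] ∪ {1}`, the point `1`
accounting for the kernel of `a_∞`. Membership in `M` follows from affiliation. -/

namespace OperatorLimits

open scoped InnerProductSpace

/-! ### Uniqueness of the resolvent -/

section Inverse

variable {H : Type*} [NormedAddCommGroup H] [InnerProductSpace ℂ H] {T : H →ₗ.[ℂ] H}
  {R : H →L[ℂ] H}

theorem IsInvOneAdd.eq {R' : H →L[ℂ] H} (h : IsInvOneAdd T R) (h' : IsInvOneAdd T R') :
    R = R' := by
  ext f
  obtain ⟨hf, hf'⟩ := h.1 f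
  have := h'.2 ⟨R f, hf⟩
  simp only [hf'] at this
  exact this.symm

/-- Lets an explicit formula replace the chosen inverse, so `partZero a` and `partInfty a` need not
be shown selfadjoint. -/
theorem IsInvOneAdd.invOneAdd_eq (h : IsInvOneAdd T R) : invOneAdd T = R := by
  have h' : ∃ R, IsInvOneAdd T R := ⟨R, h⟩
  rw [invOneAdd, dif_pos h']
  exact h'.choose_spec.eq h

theorem IsInvOneAdd.injective (h : IsInvOneAdd T R) : Function.Injective R := by
  rw [injective_iff_map_eq_zero]
  intro f hf
  obtain ⟨hf', h1⟩ := h.1 f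
  have : (⟨R f, hf'⟩ : T.domain) = 0 := Subtype.ext hf
  rw [this, hf] at h1
  simpa using h1.symm

end Inverse

/-! ### Membership in `M` and bounds on the resolvent -/

section Affiliation

variable {H : Type*} [NormedAddCommGroup H] [InnerProductSpace ℂ H] [CompleteSpace H]

theorem isClosed_vonNeumannAlgebra (M : VonNeumannAlgebra H) :
    IsClosed (M.toStarSubalgebra : Set (H →L[ℂ] H)) := by
  rw [VonNeumannAlgebra.coe_toStarSubalgebra, ← M.centralizer_centralizer]
  exact Set.isClosed_centralizer _

theorem mem_of_commute_unitary {M : VonNeumannAlgebra H} {x : H →L[ℂ] H}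
    (hx : ∀ u ∈ M.commutant, u ∈ unitary (H →L[ℂ] H) → u * x = x * u) : x ∈ M := by
  rw [← M.commutant_commutant, VonNeumannAlgebra.mem_commutant_iff]
  intro g hg
  -- Closedness makes the commutant a C⋆-algebra, in which every element is a combination of four
  -- unitaries.
  have : IsClosed (M.commutant.toStarSubalgebra : Set (H →L[ℂ] H)) :=
    isClosed_vonNeumannAlgebra _
  obtain ⟨u, c, hgu, -⟩ := CStarAlgebra.exists_sum_four_unitary
    (⟨g, hg⟩ : M.commutant.toStarSubalgebra)
  have hg' : g = ∑ i, c i • ((u i : M.commutant.toStarSubalgebra) : H →L[ℂ] H) := by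
    have := congrArg (Subtype.val) hgu
    simpa using this
  rw [hg', Finset.sum_mul, Finset.mul_sum]
  refine Finset.sum_congr rfl fun i _ => ?_
  rw [smul_mul_assoc, mul_smul_comm, hx _ (u i : M.commutant.toStarSubalgebra).2]
  exact Unitary.map_mem M.commutant.toStarSubalgebra.subtype (u i).2

theorem cfc_mem {M : VonNeumannAlgebra H} {x : H →L[ℂ] H} (hx : x ∈ M) (f : ℝ → ℝ) :
    cfc f x ∈ M := by
  rw [← M.commutant_commutant, VonNeumannAlgebra.mem_commutant_iff]
  intro g hg
  have h : Commute x g := VonNeumannAlgebra.mem_commutant_iff.1 hg x hx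
  exact (h.cfc_real f).symm.eq

theorem posPart_mem {M : VonNeumannAlgebra H} {x : H →L[ℂ] H} (hx : x ∈ M) : x⁺ ∈ M := by
  rw [CFC.posPart_def, cfcₙ_eq_cfc]
  exact cfc_mem hx _

theorem starProjection_ker_mem {M : VonNeumannAlgebra H} {x : H →L[ℂ] H} (hx : x ∈ M) :
    (LinearMap.ker x.toLinearMap).starProjection ∈ M := by
  rw [VonNeumannAlgebra.IsStarProjection.mem_iff isStarProjection_starProjection]
  intro y hy
  rw [Module.End.mem_invtSubmodule]
  intro f hf
  have hxy : x * y = y * x := VonNeumannAlgebra.mem_commutant_iff.1 hy x hx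
  simp only [Submodule.range_starProjection, Submodule.mem_comap, LinearMap.mem_ker,
    ContinuousLinearMap.coe_coe] at hf ⊢
  have := congrArg (fun z => z f) hxy
  simpa [hf] using this

variable {T : H →ₗ.[ℂ] H} {R : H →L[ℂ] H}

/-- Since `u T ⊆ T u`, the vector `u R f` solves `(1 + T) w = u f`, hence equals `R u f`. -/
theorem IsInvOneAdd.mem_of_isAffiliated {M : VonNeumannAlgebra H} (h : IsInvOneAdd T R)
    (hT : IsAffiliated M T) : R ∈ M := by
  refine mem_of_commute_unitary fun u hu hu' => ?_
  ext f
  obtain ⟨hf, hf'⟩ := h.1 f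
  obtain ⟨hu1, hu2⟩ := hT u hu hu' ⟨R f, hf⟩
  have := h.2 ⟨u (R f), hu1⟩
  simp only [hu2, ← map_add, hf'] at this
  simpa using this.symm

theorem IsPositiveSelfAdjoint.isFormalAdjoint (hT : IsPositiveSelfAdjoint T) :
    T.IsFormalAdjoint T := by
  have := T.adjoint_isFormalAdjoint hT.isSelfAdjoint.dense_domain
  rwa [LinearPMap.isSelfAdjoint_def.1 hT.isSelfAdjoint] at this

theorem IsPositiveSelfAdjoint.inner_self_eq (hT : IsPositiveSelfAdjoint T) (f : T.domain) :
    ((⟪T f, (f : H)⟫_ℂ).re : ℂ) = ⟪T f, (f : H)⟫_ℂ := by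
  rw [← Complex.conj_eq_iff_re, inner_conj_symm]
  exact (hT.isFormalAdjoint f f).symm

/-- With `f = R k`, so `k = f + T f`, one has `⟨R k, k⟩ = ‖f‖² + ⟨T f, f⟩`. The next bound uses `(1
- R) k = T f` in the same way. -/
theorem IsInvOneAdd.nonneg (h : IsInvOneAdd T R) (hT : IsPositiveSelfAdjoint T) : 0 ≤ R := by
  rw [ContinuousLinearMap.nonneg_iff_isPositive, ContinuousLinearMap.isPositive_iff_complex]
  intro k
  obtain ⟨hf, hf'⟩ := h.1 k
  set f : T.domain := ⟨R k, hf⟩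
  have hR : R k = f := rfl
  have e : ⟪R k, k⟫_ℂ = ((‖(f : H)‖ ^ 2 + (⟪T f, (f : H)⟫_ℂ).re : ℝ) : ℂ) := by
    rw [Complex.ofReal_add, hT.inner_self_eq f]
    conv_lhs => rw [← hf', hf', hR]
    rw [← hf', hR, inner_add_right, hT.isFormalAdjoint f f, inner_self_eq_norm_sq_to_K]
    simp
  rw [e]
  rw [RCLike.re_to_complex, Complex.ofReal_re]
  exact ⟨rfl, add_nonneg (sq_nonneg _) (hT.nonneg f)⟩

theorem IsInvOneAdd.le_one (h : IsInvOneAdd T R) (hT : IsPositiveSelfAdjoint T) : R ≤ 1 := by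
  rw [← sub_nonneg, ContinuousLinearMap.nonneg_iff_isPositive,
    ContinuousLinearMap.isPositive_iff_complex]
  intro k
  obtain ⟨hf, hf'⟩ := h.1 k
  set f : T.domain := ⟨R k, hf⟩
  have hR : R k = f := rfl
  have hk : (1 - R) k = T f := by
    rw [sub_apply, one_apply_eq_self, hR]
    exact sub_eq_iff_eq_add'.2 hf'.symm
  have e : ⟪(1 - R) k, k⟫_ℂ = ((‖T f‖ ^ 2 + (⟪T f, (f : H)⟫_ℂ).re : ℝ) : ℂ) := by
    rw [Complex.ofReal_add, hT.inner_self_eq f, hk]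
    nth_rewrite 1 [← hf']
    rw [hR, inner_add_right, inner_self_eq_norm_sq_to_K, add_comm]
    simp
  rw [e]
  rw [RCLike.re_to_complex, Complex.ofReal_re]
  exact ⟨rfl, add_nonneg (sq_nonneg _) (hT.nonneg f)⟩

end Affiliation
-- Resolvents of `a₀` and `a_∞` and their spectra
section Parts

variable {H : Type*} [NormedAddCommGroup H] [InnerProductSpace ℂ H]

/-- `T q` is `T` on the range of `q` and `0` on its kernel, so its resolvent is `R` on the former
and the identity on the latter. -/
theorem IsInvOneAdd.mulBounded {T : H →ₗ.[ℂ] H} {R q : H →L[ℂ] H} (h : IsInvOneAdd T R)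
    (hq : IsIdempotentElem q) (hRq : Commute R q) :
    IsInvOneAdd (mulBounded T q) (R * q + (1 - q)) := by
  have hqq : ∀ x, q (q x) = q x := fun x => congrArg (fun z => z x) hq.eq
  have hc : ∀ x, q (R x) = R (q x) := fun x => (congrArg (fun z => z x) hRq.eq).symm
  have hqR : ∀ f, q ((R * q + (1 - q)) f) = R (q f) := fun f => by simp [hqq, hc]
  refine ⟨fun f => ?_, fun f => ?_⟩
  · obtain ⟨hf, hf'⟩ := h.1 (q f)
    have hmem : (R * q + (1 - q)) f ∈ (OperatorLimits.mulBounded T q).domain := by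
      change q _ ∈ T.domain
      rw [hqR]; exact hf
    refine ⟨hmem, ?_⟩
    have e : OperatorLimits.mulBounded T q ⟨_, hmem⟩ = T ⟨R (q f), hf⟩ := by
      change T ⟨q _, _⟩ = _
      congr 1
      exact Subtype.ext (hqR f)
    rw [e]
    have : T ⟨R (q f), hf⟩ = q f - R (q f) := eq_sub_iff_add_eq'.2 hf'
    rw [this]
    simp only [add_apply, sub_apply, mul_apply_eq_comp, one_apply_eq_self]
    abel
  · have hf : q (f : H) ∈ T.domain := f.2
    have e : OperatorLimits.mulBounded T q f = T ⟨q f, hf⟩ := rfl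
    rw [e]
    set w := T ⟨q f, hf⟩
    have h1 : R (q f + w) = q f := h.2 ⟨q f, hf⟩
    -- `T` preserves the range of `q`: both sides have the same image under the injective `R`, which
    -- commutes with `q`.
    have h2 : q (q f + w) = q f + w := by
      apply h.injective
      rw [← hc, h1, hqq]
    have h3 : q w = w := by
      rw [map_add, hqq] at h2
      exact add_left_cancel h2
    have h4 : R (q f) + R w = q f := by rw [← map_add, h1]
    simp only [add_apply, sub_apply, mul_apply_eq_comp, one_apply_eq_self, map_add, h3,
      sub_self, add_zero]
    rw [eq_sub_of_add_eq' h4]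
    abel

variable [CompleteSpace H]

theorem starProjection_mul_of_mul_eq_zero {x y : H →L[ℂ] H} (hxy : x * y = 0) :
    (LinearMap.ker x.toLinearMap).starProjection * y = y := by
  ext f
  rw [mul_apply_eq_comp, Submodule.starProjection_eq_self_iff]
  exact congrArg (fun z => z f) hxy

theorem mul_starProjection_ker (x : H →L[ℂ] H) :
    x * (LinearMap.ker x.toLinearMap).starProjection = 0 := by
  ext f
  exact LinearMap.mem_ker.1 (Submodule.starProjection_apply_mem (LinearMap.ker x.toLinearMap) f)

/-- The kernel projection `p` of the positive part of a selfadjoint `x` splits `x`. -/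
theorem starProjection_ker_posPart {x p : H →L[ℂ] H} 
    (hp : p = (LinearMap.ker (x⁺ : H →L[ℂ] H).toLinearMap).starProjection) :
    x⁺ * p = 0 ∧ p * x⁺ = 0 ∧ x⁻ * p = x⁻ ∧ p * x⁻ = x⁻ := by
  have hpsa : star p = p := by
    rw [hp]; exact isStarProjection_starProjection.isSelfAdjoint.star_eq
  have hpos : star (x⁺) = x⁺ := (CFC.posPart_nonneg x).isSelfAdjoint.star_eq
  have hneg : star (x⁻) = x⁻ := (CFC.negPart_nonneg x).isSelfAdjoint.star_eq
  have h1 : x⁺ * p = 0 := by rw [hp]; exact mul_starProjection_ker _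
  have h2 : p * x⁺ = 0 := by
    have := congrArg star h1
    rwa [star_mul, hpsa, hpos, star_zero] at this
  have h3 : p * x⁻ = x⁻ := by
    rw [hp]; exact starProjection_mul_of_mul_eq_zero (CFC.posPart_mul_negPart x)
  have h4 : x⁻ * p = x⁻ := by
    have := congrArg star h3
    rwa [star_mul, hpsa, hneg] at this
  exact ⟨h1, h2, h4, h3⟩

theorem isIdempotentElem_spectralProjection (a : H →ₗ.[ℂ] H) (c : ℝ) :
    IsIdempotentElem (spectralProjection a c) :=
  isStarProjection_starProjection.isIdempotentElem

theorem star_spectralProjection (a : H →ₗ.[ℂ] H) (c : ℝ) :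
    star (spectralProjection a c) = spectralProjection a c :=
  isStarProjection_starProjection.isSelfAdjoint.star_eq

variable {a : H →ₗ.[ℂ] H}

/-- Here `y` and `z` are the positive and negative parts of `1 - 2 (1 + a)⁻¹`. The projection kills
`y` and fixes `z`, which reduces the spectral estimates to algebra in `p`, `y`, `z`. -/
theorem exists_decomposition (h : IsSelfAdjoint (invOneAdd a)) :
    ∃ y z : H →L[ℂ] H, 0 ≤ y ∧ 0 ≤ z ∧ invOneAdd a = (2⁻¹ : ℝ) • (1 - y + z) ∧
      y * spectralProjection a 1 = 0 ∧ spectralProjection a 1 * y = 0 ∧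
      z * spectralProjection a 1 = z ∧ spectralProjection a 1 * z = z := by
  have hx : IsSelfAdjoint (1 - (2 : ℝ) • invOneAdd a) :=
    (IsSelfAdjoint.one _).sub ((IsSelfAdjoint.all (2 : ℝ)).smul h)
  obtain ⟨h1, h2, h3, h4⟩ := starProjection_ker_posPart (x := 1 - (2 : ℝ) • invOneAdd a)
    (p := spectralProjection a 1) (by
    simp only [spectralProjection, one_add_one_eq_two])
  refine ⟨_, _, CFC.posPart_nonneg _, CFC.negPart_nonneg _, ?_, h1, h2, h3, h4⟩
  have hx' := CFC.posPart_sub_negPart _ hx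
  set y := (1 - (2 : ℝ) • invOneAdd a)⁺
  set z := (1 - (2 : ℝ) • invOneAdd a)⁻
  have e : 1 - y + z = 1 - (y - z) := by abel
  rw [e, hx', sub_sub_cancel, smul_smul]
  norm_num

theorem commute_spectralProjection_one (h : IsSelfAdjoint (invOneAdd a)) :
    Commute (invOneAdd a) (spectralProjection a 1) := by
  obtain ⟨y, z, -, -, hR, h1, h2, h3, h4⟩ := exists_decomposition h
  rw [hR]
  refine Commute.smul_left (((Commute.one_left _).sub_left ?_).add_left ?_) _
  · exact h1.trans h2.symm
  · exact h3.trans h4.symm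

theorem invOneAdd_partZero (ha : IsPositiveSelfAdjoint a) :
    IsInvOneAdd (partZero a)
      (invOneAdd a * spectralProjection a 1 + (1 - spectralProjection a 1)) :=
  have h := isInvOneAdd_invOneAdd ha
  h.mulBounded (isIdempotentElem_spectralProjection a 1)
    (commute_spectralProjection_one (h.nonneg ha).isSelfAdjoint)

theorem invOneAdd_partInfty (ha : IsPositiveSelfAdjoint a) :
    IsInvOneAdd (partInfty a)
      (invOneAdd a * (1 - spectralProjection a 1) + (1 - (1 - spectralProjection a 1))) :=
  have h := isInvOneAdd_invOneAdd ha
  h.mulBounded (isIdempotentElem_spectralProjection a 1).one_sub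
    ((Commute.one_right _).sub_right
      (commute_spectralProjection_one (h.nonneg ha).isSelfAdjoint))

theorem spectrum_partZero (ha : IsPositiveSelfAdjoint a) :
    0 ≤ invOneAdd (partZero a) ∧
      ∀ t ∈ spectrum ℝ (invOneAdd (partZero a)), 2⁻¹ ≤ t ∧ t ≤ 1 := by
  have h := isInvOneAdd_invOneAdd ha
  have hp := isIdempotentElem_spectralProjection a 1
  have hps := star_spectralProjection a 1
  have hR1 := sub_nonneg.2 (h.le_one ha)
  obtain ⟨y, z, hy, hz, hR, h1, h2, h3, h4⟩ := exists_decomposition (h.nonneg ha).isSelfAdjoint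
  rw [(invOneAdd_partZero ha).invOneAdd_eq]
  have hp1 : (0 : H →L[ℂ] H) ≤ 1 - spectralProjection a 1 :=
    isStarProjection_starProjection.one_sub.nonneg
  set p := spectralProjection a 1
  set Q := invOneAdd a * p + (1 - p) with hQdef
  have hQ : Q = (2⁻¹ : ℝ) • (1 + (1 - p) + z) := by
    rw [hQdef, hR, smul_mul_assoc, add_mul, sub_mul, one_mul, h1, h3]
    module
  have hQ0 : algebraMap ℝ (H →L[ℂ] H) 2⁻¹ ≤ Q := by
    rw [← sub_nonneg, hQ, Algebra.algebraMap_eq_smul_one, ← smul_sub]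
    refine smul_nonneg (by norm_num) ?_
    rw [add_assoc, add_sub_cancel_left]
    exact add_nonneg hp1 hz
  have hQ1 : Q ≤ 1 := by
    rw [← sub_nonneg]
    have := star_left_conjugate_nonneg hR1 p
    -- The upper bound is `1 - R ≥ 0` compressed to the range of `p`.
    have e : star p * (1 - invOneAdd a) * p = 1 - Q := by
      rw [hps, hQ, hR, mul_sub, sub_mul, mul_one, mul_smul_comm, smul_mul_assoc, mul_add, mul_sub,
        h2, h4, mul_one, sub_zero, add_mul, h3, hp.eq]
      module
    rwa [e] at this
  have hQpos : 0 ≤ Q := le_trans (algebraMap_nonneg (H →L[ℂ] H) (by norm_num)) hQ0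
  refine ⟨hQpos, fun t ht => ⟨?_, ?_⟩⟩
  · exact (algebraMap_le_iff_le_spectrum (ha := hQpos.isSelfAdjoint)).1 hQ0 t ht
  · exact (le_algebraMap_iff_spectrum_le (ha := hQpos.isSelfAdjoint)).1 (by simpa using hQ1) t ht

theorem spectrum_mul_sub_nonneg {Q : H →L[ℂ] H} (hQ : IsSelfAdjoint Q) {r s : ℝ}
    (h : 0 ≤ (Q - r • 1) * (Q - s • 1)) : ∀ t ∈ spectrum ℝ Q, 0 ≤ (t - r) * (t - s) := by
  have key : ∀ c : ℝ, cfc (fun t : ℝ => t - c) Q = Q - c • 1 := fun c => by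
    rw [cfc_sub (fun t : ℝ => t) (fun _ => c) Q continuousOn_id continuousOn_const,
      cfc_id' ℝ Q hQ, cfc_const c Q hQ, Algebra.algebraMap_eq_smul_one]
  have hc : ∀ c : ℝ, ContinuousOn (fun t : ℝ => t - c) (spectrum ℝ Q) := fun c => by fun_prop
  rw [← key, ← key, ← cfc_mul _ _ Q (hc r) (hc s)] at h
  exact (cfc_nonneg_iff _ Q ((hc r).mul (hc s)) hQ).1 h

theorem spectrum_partInfty (ha : IsPositiveSelfAdjoint a) :
    0 ≤ invOneAdd (partInfty a) ∧
      ∀ t ∈ spectrum ℝ (invOneAdd (partInfty a)), 0 ≤ t ∧ (t ≤ 2⁻¹ ∨ t = 1) := by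
  have h := isInvOneAdd_invOneAdd ha
  have hp := isIdempotentElem_spectralProjection a 1
  have hps := star_spectralProjection a 1
  have hR0 := h.nonneg ha
  have hc : Commute (invOneAdd a) (1 - spectralProjection a 1) :=
    (Commute.one_right _).sub_right (commute_spectralProjection_one hR0.isSelfAdjoint)
  obtain ⟨y, z, hy, hz, hR, h1, h2, h3, h4⟩ := exists_decomposition (h.nonneg ha).isSelfAdjoint
  rw [(invOneAdd_partInfty ha).invOneAdd_eq]
  have hp0 : (0 : H →L[ℂ] H) ≤ spectralProjection a 1 :=
    isStarProjection_starProjection.nonneg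
  have hp1 : (0 : H →L[ℂ] H) ≤ 1 - spectralProjection a 1 :=
    isStarProjection_starProjection.one_sub.nonneg
  set p := spectralProjection a 1
  set Q := invOneAdd a * (1 - p) + (1 - (1 - p)) with hQdef
  have hQ : Q = (2⁻¹ : ℝ) • (1 + p - y) := by
    rw [hQdef, hR, smul_mul_assoc, mul_sub, mul_one, add_mul, sub_mul, one_mul, h1, h3]
    module
  have hQpos : 0 ≤ Q := by
    have := add_nonneg (star_left_conjugate_nonneg hR0 (1 - p)) hp0
    have e : star (1 - p) * invOneAdd a * (1 - p) + p = Q := by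
      rw [star_sub, star_one, hps, ← hc.eq, mul_assoc, hp.one_sub.eq, hQdef, sub_sub_cancel]
    rwa [e] at this
  have hQ1 : Q ≤ 1 := by
    have e : 1 - Q = (2⁻¹ : ℝ) • ((1 - p) + y) := by
      rw [hQ]; module
    rw [← sub_nonneg, e]
    exact smul_nonneg (by norm_num) (add_nonneg hp1 hy)
  have hsa := hQpos.isSelfAdjoint
  -- The gap: `(Q - 1)(Q - 1/2) = (y + y²)/4 ≥ 0` excludes spectrum in `(1/2, 1)`.
  have hquad := spectrum_mul_sub_nonneg hsa (r := 1) (s := 2⁻¹) (by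
    rw [one_smul]
    have e1 : Q - 1 = (-2⁻¹ : ℝ) • (1 - p + y) := by
      rw [hQ]; module
    have e2 : Q - (2⁻¹ : ℝ) • (1 : H →L[ℂ] H) = (2⁻¹ : ℝ) • (p - y) := by
      rw [hQ]; module
    have e3 : (Q - 1) * (Q - (2⁻¹ : ℝ) • 1) = (4⁻¹ : ℝ) • (y + star y * y) := by
      rw [e1, e2, smul_mul_smul_comm, mul_sub, add_mul, add_mul, sub_mul, sub_mul, one_mul, one_mul,
        hp.eq, h1, h2, hy.isSelfAdjoint.star_eq]
      module
    rw [e3]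
    exact smul_nonneg (by norm_num) (add_nonneg hy (star_mul_self_nonneg y)))
  refine ⟨hQpos, fun t ht => ⟨spectrum_nonneg_of_nonneg hQpos ht, ?_⟩⟩
  have ht1 : t ≤ 1 :=
    (le_algebraMap_iff_spectrum_le (ha := hQpos.isSelfAdjoint)).1 (by simpa using hQ1) t ht
  rcases ht1.lt_or_eq with hlt | heq
  · left
    have := hquad t ht
    by_contra hcon
    push Not at hcon
    nlinarith [mul_pos (sub_pos.2 hlt) (sub_pos.2 hcon)]
  · exact Or.inr heq

variable {M : VonNeumannAlgebra H}

theorem smul_real_mem {x : H →L[ℂ] H} (hx : x ∈ M) (r : ℝ) : r • x ∈ M := by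
  rw [← Complex.coe_smul]
  exact M.toStarSubalgebra.smul_mem hx (r : ℂ)

theorem spectralProjection_mem (ha : IsPositiveSelfAdjoint a) (haM : IsAffiliated M a) (c : ℝ) :
    spectralProjection a c ∈ M :=
  starProjection_ker_mem <| posPart_mem <| sub_mem (one_mem M) <|
    smul_real_mem ((isInvOneAdd_invOneAdd ha).mem_of_isAffiliated haM) _

theorem invOneAdd_partZero_mem (ha : IsPositiveSelfAdjoint a) (haM : IsAffiliated M a) :
    invOneAdd (partZero a) ∈ M := by
  have hp := spectralProjection_mem ha haM 1
  rw [(invOneAdd_partZero ha).invOneAdd_eq]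
  exact add_mem (mul_mem ((isInvOneAdd_invOneAdd ha).mem_of_isAffiliated haM) hp)
    (sub_mem (one_mem M) hp)

theorem invOneAdd_partInfty_mem (ha : IsPositiveSelfAdjoint a) (haM : IsAffiliated M a) :
    invOneAdd (partInfty a) ∈ M := by
  have hp := sub_mem (one_mem M) (spectralProjection_mem ha haM 1)
  rw [(invOneAdd_partInfty ha).invOneAdd_eq]
  exact add_mem (mul_mem ((isInvOneAdd_invOneAdd ha).mem_of_isAffiliated haM) hp)
    (sub_mem (one_mem M) hp)

end Parts
-- Comparison of two powers by a bounded multiplier in `M`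
section Powers

theorem continuous_rpow_of_pos {α : ℝ} (hα : 0 < α) : Continuous fun t : ℝ => t ^ α :=
  Real.continuous_rpow_const hα.le

theorem continuous_one_sub_rpow {α : ℝ} (hα : 0 < α) : Continuous fun t : ℝ => (1 - t) ^ α :=
  (continuous_rpow_of_pos hα).comp (continuous_const.sub continuous_id)

variable {H : Type*} [NormedAddCommGroup H] [InnerProductSpace ℂ H]

theorem injective_pow {R : H →L[ℂ] H} (hR : Function.Injective R) (n : ℕ) :
    Function.Injective (R ^ n) := by
  rw [FunLike.coe_pow_eq_iterate]
  exact hR.iterate n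

variable [CompleteSpace H]

theorem cfc_rpow_mul_cfc_rpow {R : H →L[ℂ] H} (hR : 0 ≤ R) {α δ : ℝ} (hα : 0 < α) (hδ : 0 < δ) :
    cfc (fun t : ℝ => t ^ (α + δ)) R = cfc (fun t : ℝ => t ^ α) R * cfc (fun t : ℝ => t ^ δ) R := by
  rw [← cfc_mul _ _ R (continuous_rpow_of_pos hα).continuousOn
    (continuous_rpow_of_pos hδ).continuousOn]
  exact cfc_congr fun t ht =>
    Real.rpow_add' (spectrum_nonneg_of_nonneg hR ht) (add_pos hα hδ).ne'

/-- For an integer `n > α`, `R^α` is the right factor of the injective operator `R^n = R^(n-α) R^α`.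
-/
theorem cfc_rpow_injective {R : H →L[ℂ] H} (hR : 0 ≤ R) (hinj : Function.Injective R) {α : ℝ}
    (hα : 0 < α) : Function.Injective (cfc (fun t : ℝ => t ^ α) R : H →L[ℂ] H) := by
  obtain ⟨n, hn⟩ := exists_nat_gt α
  have e : R ^ n = cfc (fun t : ℝ => t ^ (n - α)) R * cfc (fun t : ℝ => t ^ α) R := by
    rw [← cfc_rpow_mul_cfc_rpow hR (sub_pos.2 hn) hα, ← cfc_pow_id (R := ℝ) R n hR.isSelfAdjoint]
    exact cfc_congr fun t _ => by simp
  have h := injective_pow hinj n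
  rw [e] at h
  exact Function.Injective.of_comp (f := (cfc (fun t : ℝ => t ^ (n - α)) R : H →L[ℂ] H)) h

variable {T : H →ₗ.[ℂ] H}

theorem mem_power_domain {α : ℝ} {f : H} :
    f ∈ (power T α).domain ↔ ∃ k, cfc (fun t : ℝ => t ^ α) (invOneAdd T) k = f := by
  change f ∈ (LinearPMap.inverse _).domain ↔ _
  rw [LinearPMap.inverse_domain, LinearMap.mem_range]
  exact ⟨fun ⟨k, hk⟩ => ⟨k, hk⟩, fun ⟨k, hk⟩ => ⟨⟨k, trivial⟩, hk⟩⟩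

theorem power_apply {α : ℝ} (hinj : Function.Injective (cfc (fun t : ℝ => t ^ α) (invOneAdd T) : H →L[ℂ] H))
    (f : (power T α).domain) {k : H} (hk : cfc (fun t : ℝ => t ^ α) (invOneAdd T) k = f) :
    power T α f = cfc (fun t : ℝ => (1 - t) ^ α) (invOneAdd T) k := by
  have hker : ((cfc (fun t : ℝ => t ^ α) (invOneAdd T) : H →L[ℂ] H).toLinearMap.toPMap
      ⊤).toFun.ker = ⊥ := by
    rw [LinearMap.ker_eq_bot']
    intro m hm
    exact Subtype.ext (hinj (hm.trans (map_zero _).symm))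
  have := LinearPMap.inverse_apply_eq hker (y := f) (x := ⟨k, trivial⟩) hk
  exact congrArg (cfc (fun t : ℝ => (1 - t) ^ α) (invOneAdd T) : H →L[ℂ] H) this

/-- Two powers of `T` at a common vector, expressed by bounded functions of `(1 + T)⁻¹` at one
vector. -/
theorem exists_power_eq (h : IsInvOneAdd T (invOneAdd T)) (hR : 0 ≤ invOneAdd T) {α δ : ℝ}
    (hα : 0 < α) (hδ : 0 < δ) {f : H} (hf : f ∈ (power T α).domain)
    (hf' : f ∈ (power T (α + δ)).domain) :
    ∃ k, power T α ⟨f, hf⟩ = cfc (fun t : ℝ => (1 - t) ^ α * t ^ δ) (invOneAdd T) k ∧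
      power T (α + δ) ⟨f, hf'⟩ = cfc (fun t : ℝ => (1 - t) ^ (α + δ)) (invOneAdd T) k := by
  obtain ⟨k, hk⟩ := mem_power_domain.1 hf'
  refine ⟨k, ?_, power_apply (cfc_rpow_injective hR h.injective (add_pos hα hδ)) _ hk⟩
  -- Since `f = R^α (R^δ k)`, the preimage of `f` for the exponent `α` is `R^δ k`.
  rw [cfc_rpow_mul_cfc_rpow hR hα hδ] at hk
  rw [power_apply (cfc_rpow_injective hR h.injective hα) ⟨f, hf⟩ hk,
    cfc_mul _ _ _ (continuous_one_sub_rpow hα).continuousOn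
      (continuous_rpow_of_pos hδ).continuousOn]
  rfl

/-- Truncating the denominator at `1/2` gives a globally continuous multiplier, unchanged wherever
`v t ≥ 1/2`. -/
theorem continuous_div_max_rpow {u v : ℝ → ℝ} (hu : Continuous u) (hv : Continuous v) {δ : ℝ}
    (hδ : 0 < δ) : Continuous fun t => (u t / max (v t) 2⁻¹) ^ δ :=
  (continuous_rpow_of_pos hδ).comp <| hu.div (hv.max continuous_const) fun t =>
    (lt_max_of_lt_right (by norm_num)).ne'

variable {a : H →ₗ.[ℂ] H} {M : VonNeumannAlgebra H}

/-- With `t = (1 + λ)⁻¹` one has `λ = (1 - t)/t`, so the multiplier is `a₀^δ`; it is bounded because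
`t ≥ 1/2` on the spectrum. -/
theorem exists_mem_power_partZero (ha : IsPositiveSelfAdjoint a) (haM : IsAffiliated M a)
    {α δ : ℝ} (hα : 0 < α) (hδ : 0 < δ) :
    ∃ y ∈ M, ∀ (f : H) (hf : f ∈ (power (partZero a) α).domain)
      (hf' : f ∈ (power (partZero a) (α + δ)).domain),
      power (partZero a) (α + δ) ⟨f, hf'⟩ = y (power (partZero a) α ⟨f, hf⟩) := by
  obtain ⟨hR, hspec⟩ := spectrum_partZero ha
  have h := invOneAdd_partZero ha
  rw [← h.invOneAdd_eq] at h
  refine ⟨cfc (fun t : ℝ => ((1 - t) / max t 2⁻¹) ^ δ) (invOneAdd (partZero a)),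
    cfc_mem (invOneAdd_partZero_mem ha haM) _, fun f hf hf' => ?_⟩
  obtain ⟨k, h1, h2⟩ := exists_power_eq h hR hα hδ hf hf'
  have hc1 : Continuous fun t : ℝ => (1 - t) ^ α * t ^ δ :=
    (continuous_one_sub_rpow hα).mul (continuous_rpow_of_pos hδ)
  have hc2 : Continuous fun t : ℝ => ((1 - t) / max t 2⁻¹) ^ δ :=
    continuous_div_max_rpow (continuous_const.sub continuous_id) continuous_id hδ
  rw [h1, h2, ← mul_apply_eq_comp, ← cfc_mul _ _ _ hc2.continuousOn hc1.continuousOn]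
  congr 1
  refine cfc_congr fun t ht => ?_
  obtain ⟨ht1, ht2⟩ := hspec t ht
  have ht0 : 0 < t := lt_of_lt_of_le (by norm_num) ht1
  have ht3 : 0 ≤ 1 - t := sub_nonneg.2 ht2
  rw [max_eq_left ht1, Real.div_rpow ht3 ht0.le, Real.rpow_add' ht3 (add_pos hα hδ).ne']
  have := (Real.rpow_pos_of_pos ht0 δ).ne'
  field_simp

/-- Now the multiplier is `λ^(-δ) = (t/(1 - t))^δ`, bounded for `t ≤ 1/2`; hence the comparison goes
from the larger exponent to the smaller. -/
theorem exists_mem_power_partInfty (ha : IsPositiveSelfAdjoint a) (haM : IsAffiliated M a)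
    {α δ : ℝ} (hα : 0 < α) (hδ : 0 < δ) :
    ∃ y ∈ M, ∀ (f : H) (hf : f ∈ (power (partInfty a) α).domain)
      (hf' : f ∈ (power (partInfty a) (α + δ)).domain),
      power (partInfty a) α ⟨f, hf⟩ = y (power (partInfty a) (α + δ) ⟨f, hf'⟩) := by
  obtain ⟨hR, hspec⟩ := spectrum_partInfty ha
  have h := invOneAdd_partInfty ha
  rw [← h.invOneAdd_eq] at h
  refine ⟨cfc (fun t : ℝ => (t / max (1 - t) 2⁻¹) ^ δ) (invOneAdd (partInfty a)),
    cfc_mem (invOneAdd_partInfty_mem ha haM) _, fun f hf hf' => ?_⟩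
  obtain ⟨k, h1, h2⟩ := exists_power_eq h hR hα hδ hf hf'
  have hc1 : Continuous fun t : ℝ => (1 - t) ^ (α + δ) :=
    continuous_one_sub_rpow (add_pos hα hδ)
  have hc2 : Continuous fun t : ℝ => (t / max (1 - t) 2⁻¹) ^ δ :=
    continuous_div_max_rpow continuous_id (continuous_const.sub continuous_id) hδ
  rw [h1, h2, ← mul_apply_eq_comp, ← cfc_mul _ _ _ hc2.continuousOn hc1.continuousOn]
  congr 1
  refine cfc_congr fun t ht => ?_
  obtain ⟨ht0, ht1 | rfl⟩ := hspec t ht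
  · have ht2 : 2⁻¹ ≤ 1 - t := by norm_num at ht1 ⊢; linarith
    have ht3 : 0 < 1 - t := lt_of_lt_of_le (by norm_num) ht2
    rw [max_eq_left ht2, Real.div_rpow ht0 ht3.le, Real.rpow_add ht3]
    have := (Real.rpow_pos_of_pos ht3 δ).ne'
    field_simp
  -- At `t = 1`, the kernel of `a_∞`, the truncated value is irrelevant: both powers vanish because
  -- the exponents are positive.
  · simp [Real.zero_rpow hα.ne', Real.zero_rpow (add_pos hα hδ).ne']

end Powers

/-! ### Monotonicity of the family in each index -/

section Family

variable {H : Type*} [NormedAddCommGroup H] [InnerProductSpace ℂ H] [CompleteSpace H]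
  {M : VonNeumannAlgebra H} {a : H →ₗ.[ℂ] H}

theorem mem_family {α β : Set.Ioi (0 : ℝ)} {φ : CommonForm a} :
    φ ∈ family M a α β ↔ ∃ x ∈ M, ∀ (f : commonDomain (partInfty a))
      (g : commonDomain (partZero a)),
      φ f g = ⟪power (partZero a) α ⟨g, commonDomain_le _ α.2 g.2⟩,
        x (power (partInfty a) β ⟨f, commonDomain_le _ β.2 f.2⟩)⟫_ℂ := by
  constructor
  · rintro ⟨_, ⟨x, hx, rfl⟩, rfl⟩
    exact ⟨x, hx, fun f g => rfl⟩
  · rintro ⟨x, hx, hφ⟩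
    exact ⟨_, ⟨x, hx, rfl⟩, LinearMap.ext fun f => LinearMap.ext fun g => (hφ f g).symm⟩

theorem family_antitone_left (ha : IsPositiveSelfAdjoint a) (haM : IsAffiliated M a)
    {α α' : Set.Ioi (0 : ℝ)} (h : α ≤ α') (β : Set.Ioi (0 : ℝ)) :
    family M a α' β ≤ family M a α β := by
  rcases h.eq_or_lt with rfl | h
  · exact le_rfl
  obtain ⟨α', hα'⟩ := α'
  obtain ⟨δ, hδ, rfl⟩ : ∃ δ : ℝ, 0 < δ ∧ (α : ℝ) + δ = α' :=
    ⟨α' - α, sub_pos.2 h, add_sub_cancel _ _⟩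
  obtain ⟨y, hy, hyf⟩ := exists_mem_power_partZero ha haM α.2 hδ
  intro φ hφ
  obtain ⟨x, hx, hφ⟩ := mem_family.1 hφ
  -- The multiplier sits next to `g`, so it reaches `x` as an adjoint.
  refine mem_family.2 ⟨star y * x, mul_mem (star_mem hy) hx, fun f g => ?_⟩
  rw [hφ, hyf g (commonDomain_le _ α.2 g.2), mul_apply_eq_comp,
    ContinuousLinearMap.star_eq_adjoint, ContinuousLinearMap.adjoint_inner_right]

theorem family_monotone_right (ha : IsPositiveSelfAdjoint a) (haM : IsAffiliated M a)
    (α : Set.Ioi (0 : ℝ)) {β β' : Set.Ioi (0 : ℝ)} (h : β ≤ β') :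
    family M a α β ≤ family M a α β' := by
  rcases h.eq_or_lt with rfl | h
  · exact le_rfl
  obtain ⟨β', hβ'⟩ := β'
  obtain ⟨δ, hδ, rfl⟩ : ∃ δ : ℝ, 0 < δ ∧ (β : ℝ) + δ = β' :=
    ⟨β' - β, sub_pos.2 h, add_sub_cancel _ _⟩
  obtain ⟨y, hy, hyf⟩ := exists_mem_power_partInfty ha haM β.2 hδ
  intro φ hφ
  obtain ⟨x, hx, hφ⟩ := mem_family.1 hφ
  refine mem_family.2 ⟨x * y, mul_mem hx hy, fun f g => ?_⟩
  rw [hφ, hyf f (commonDomain_le _ β.2 f.2) (commonDomain_le _ hβ' f.2), mul_apply_eq_comp]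

end Family

/-! ### Order theory of the four limits -/

section Limits

variable {X : Type*} [AddCommGroup X] [Module ℂ X]
  {S : Set.Ioi (0 : ℝ) → Set.Ioi (0 : ℝ) → Submodule ℂ X}

theorem diagLimsup_subset_upperLimit (hS : ∀ {α α'} β, α ≤ α' → S α' β ≤ S α β) :
    diagLimsup S ⊆ upperLimit S := by
  intro φ hφ
  simp only [diagLimsup, upperLimit, unionSpace, Set.mem_iInter, Set.mem_iUnion] at hφ ⊢
  intro α
  obtain ⟨β, hαβ, hβ⟩ := hφ α
  exact ⟨β, hS β hαβ hβ⟩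

theorem diagLiminf_subset_diagLimsup : diagLiminf S ⊆ diagLimsup S := by
  intro φ hφ
  simp only [diagLimsup, diagLiminf, Set.mem_iInter, Set.mem_iUnion] at hφ ⊢
  obtain ⟨α, hα⟩ := hφ
  exact fun α' => ⟨max α α', le_max_right _ _, hα _ (le_max_left _ _)⟩

theorem lowerLimit_subset_diagLiminf (hS : ∀ α {β β'}, β ≤ β' → S α β ≤ S α β') :
    lowerLimit S ⊆ diagLiminf S := by
  intro φ hφ
  simp only [diagLiminf, lowerLimit, interSpace, Set.mem_iInter, Set.mem_iUnion] at hφ ⊢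
  obtain ⟨β, hβ⟩ := hφ
  exact ⟨β, fun β' h => hS β' h (hβ β')⟩

end Limits

end OperatorLimits

theorem mainTheorem5 {H : Type*} [NormedAddCommGroup H] [InnerProductSpace ℂ H] [CompleteSpace H]
    (M : VonNeumannAlgebra H) (a : H →ₗ.[ℂ] H)
    (ha : OperatorLimits.IsPositiveSelfAdjoint a) (haM : OperatorLimits.IsAffiliated M a) :
    OperatorLimits.diagLimsup (OperatorLimits.family M a) ⊆
        OperatorLimits.upperLimit (OperatorLimits.family M a) ∧
      OperatorLimits.diagLiminf (OperatorLimits.family M a) ⊆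
        OperatorLimits.diagLimsup (OperatorLimits.family M a) ∧
      OperatorLimits.lowerLimit (OperatorLimits.family M a) ⊆
        OperatorLimits.diagLiminf (OperatorLimits.family M a) ∧
      ∀ L : Set (OperatorLimits.CommonForm a),
        OperatorLimits.ConvergesTo (OperatorLimits.family M a) L →
          OperatorLimits.diagLimsup (OperatorLimits.family M a) = L ∧
            OperatorLimits.diagLiminf (OperatorLimits.family M a) = L := by
  have h1 := OperatorLimits.diagLimsup_subset_upperLimit (S := OperatorLimits.family M a)
    fun β h => OperatorLimits.family_antitone_left ha haM h β
  have h2 := OperatorLimits.diagLiminf_subset_diagLimsup (S := OperatorLimits.family M a)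
  have h3 := OperatorLimits.lowerLimit_subset_diagLiminf (S := OperatorLimits.family M a)
    fun α _ _ h => OperatorLimits.family_monotone_right ha haM α h
  refine ⟨h1, h2, h3, ?_⟩
  rintro L ⟨hlower, hupper⟩
  rw [hupper] at h1
  rw [hlower] at h3
  exact ⟨h1.antisymm (h3.trans h2), (h2.trans h1).antisymm h3⟩
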